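/- Let $G=(V,E)$ be a finite connected graph, possibly with parallel edges and loops, and replace each edge by two opposite oriented edges $e,\bar e$; let $\mathbb E$ be the set of oriented edges. Let $\mathcal H$ be the real vector space of flows in $G$, that is, of functions $x:\mathbb E\to\mathbb R$ with $x_{\bar e}=-x_e$ for all $e\in\mathbb E$ and $\sum_{e \text{ with tail } v}x_e=0$ for every vertex $v$. Let $\Lambda\subset\mathcal H$ be the lattice of integer-valued flows. Put $\langle x,y\rangle=\sum_{e\in E}x_ey_e$ (one orientation chosen for each edge; each edge counted once) and $q(x)=\langle x,x\rangle$. The covering number $\mathrm{Cov}(\Lambda)$ is the smallest real number $r$ such that for every $x\in\mathcal H$ there is $m\in\Lambda$ with $q(x-m)\le r$. A strongly connected orientation of $G$ means an orientation $D$ of the graph obtained from $G$ by deleting all its bridges such that, inside each connected component of that graph, any vertex can be reached from any other along $D$. For a circuit $C$ (an orientation of a cycle; loops and pairs of parallel edges give cycles), let $\ell(C)$ be its number of edges and $x^C\in\Lambda$ the flow that is $1$ on the oriented edges of $C$, $-1$ on their inverses, and $0$ elsewhere. Let $\Delta(f)(y)=\sum_{e\text{ with tail }y}\bigl(f(y)-f(\mathrm{head}(e))\bigr)$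 be the Laplacian of $G$ on functions $f:V\to\mathbb R$, with $\langle f,g\rangle=\sum_{y\in V}f(y)g(y)$ for such functions, and let $d^{\mathrm{out}}$, $d^{\mathrm{in}}$ be the out- and in-degree functions of $D$. Let $\epsilon$ be the number of edges of $G$ that are not bridges. Then the smallest $r$ defining $\mathrm{Cov}(\Lambda)$ exists, and the following hold. 1. For every strongly connected orientation $D$ of $G$ there is a unique $v^D\in\mathcal H$ with $2\langle v^D,x^C\rangle=\ell(C)$ for all circuits $C\subset D$, and $\mathrm{Cov}(\Lambda)$ is the maximum of $q(v^D)$ over all strongly connected orientations $D$ of $G$. 2. For every strongly connected orientation $D$ of $G$ the equation $\Delta(f_D)=d^{\mathrm{out}}-d^{\mathrm{in}}$ has a solution $f_D:V\to\mathbb R$, unique up to an additive constant. Call $D$ well-balanced if $\langle f_D,\Delta(f_D)\rangle$ is minimal among all strongly connected orientations of $G$. Well-balanced orientations exist, and for every well-balanced $D$ $$\mathrm{Cov}(\Lambda)=\frac{\epsilon}{4}-\frac14\langle f_D,\Delta(f_D)\rangle .$$ 3. If $G$ is Eulerian (every vertex has even degree, a loop counting twice), then $\mathrm{Cov}(\Lambda)=\dfrac{|E|}{4}$.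 -/

import Mathlib

/-- A multigraph with vertex set `V` and edge set `E`; parallel edges and loops are allowed.
The two ends of an edge are listed in an arbitrary reference order, which serves only to name
the two oriented edges carried by that edge (two distinct ones also for a loop). -/
structure MultiG (V E : Type*) where
  /-- first end of an edge -/
  fstEnd : E → V
  /-- second end of an edge -/
  sndEnd : E → V

namespace MultiG

variable {V E : Type*}

/-- The set of oriented edges: each edge is replaced with two oriented edges,
`(e, true)` from `fstEnd e` to `sndEnd e`, and `(e, false)` in the opposite direction. -/
abbrev OEdge (E : Type*) := E × Bool

/-- The inverse of an oriented edge. -/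
def rev (a : OEdge E) : OEdge E := (a.1, !a.2)

/-- The tail of an oriented edge. -/
def tail (G : MultiG V E) (a : OEdge E) : V := if a.2 then G.fstEnd a.1 else G.sndEnd a.1

/-- The head of an oriented edge. -/
def head (G : MultiG V E) (a : OEdge E) : V := if a.2 then G.sndEnd a.1 else G.fstEnd a.1

/-- There is an oriented path from `u` to `v` that uses only oriented edges from `S`. -/
def Reach (G : MultiG V E) (S : Set (OEdge E)) (u v : V) : Prop :=
  Relation.ReflTransGen (fun x y => ∃ a ∈ S, G.tail a = x ∧ G.head a = y) u v

/-- The graph is connected. -/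
def Connected (G : MultiG V E) : Prop :=
  Nonempty V ∧ ∀ u v : V, G.Reach Set.univ u v

/-- An edge is a bridge if its two ends are not connected after the edge is deleted. -/
def IsBridge (G : MultiG V E) (e : E) : Prop :=
  ¬ G.Reach {a | a.1 ≠ e} (G.fstEnd e) (G.sndEnd e)

/-- The number of edges that are not bridges. -/
noncomputable def numNonBridge (G : MultiG V E) : ℕ := Nat.card {e : E // ¬ G.IsBridge e}

/-- `D` is a strongly connected orientation of the whole graph, which means: of the graph minus
the set of its bridges. It contains exactly one of the two oriented edges of each non-bridge edge,
no orientation of a bridge, and inside each connected component of the graph minus its bridges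
any vertex can be reached from any other along `D`. -/
structure IsStrongOrientation (G : MultiG V E) (D : Finset (OEdge E)) : Prop where
  not_bridge : ∀ a ∈ D, ¬ G.IsBridge a.1
  exactly_one : ∀ e : E, ¬ G.IsBridge e → Xor ((e, true) ∈ D) ((e, false) ∈ D)
  strong : ∀ u v : V, G.Reach {a | ¬ G.IsBridge a.1} u v → G.Reach (↑D) u v

section Flows

variable [Fintype V] [DecidableEq V] [Fintype E] [DecidableEq E]

/-- The real vector space of real-valued flows: antisymmetric functions on oriented edges
whose sum over the oriented edges leaving any vertex is zero. -/
def flowSpace (G : MultiG V E) : Submodule ℝ (OEdge E → ℝ) where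
  carrier := {x | (∀ a, x (rev a) = - x a) ∧
    ∀ v : V, ∑ a ∈ Finset.univ.filter (fun a => G.tail a = v), x a = 0}
  add_mem' := by
    rintro x y ⟨hx, hx'⟩ ⟨hy, hy'⟩
    refine ⟨fun a => ?_, fun v => ?_⟩
    · simp only [Pi.add_apply, hx a, hy a]; ring
    · simp only [Pi.add_apply, Finset.sum_add_distrib, hx' v, hy' v, add_zero]
  zero_mem' := ⟨fun a => by simp, fun v => by simp⟩
  smul_mem' := by
    rintro c x ⟨hx, hx'⟩
    refine ⟨fun a => ?_, fun v => ?_⟩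
    · simp only [Pi.smul_apply, smul_eq_mul, hx a]; ring
    · simp only [Pi.smul_apply, smul_eq_mul, ← Finset.mul_sum, hx' v, mul_zero]

/-- The lattice of integer flows: the flows all of whose values are integers. -/
def flowLattice (G : MultiG V E) : AddSubgroup (OEdge E → ℝ) where
  carrier := {x | x ∈ G.flowSpace ∧ ∀ a, ∃ n : ℤ, x a = n}
  add_mem' := by
    rintro x y ⟨hx, hx'⟩ ⟨hy, hy'⟩
    refine ⟨G.flowSpace.add_mem hx hy, fun a => ?_⟩
    obtain ⟨m, hm⟩ := hx' a
    obtain ⟨n, hn⟩ := hy' a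
    exact ⟨m + n, by simp [hm, hn]⟩
  zero_mem' := ⟨G.flowSpace.zero_mem, fun a => ⟨0, by simp⟩⟩
  neg_mem' := by
    rintro x ⟨hx, hx'⟩
    refine ⟨G.flowSpace.neg_mem hx, fun a => ?_⟩
    obtain ⟨m, hm⟩ := hx' a
    exact ⟨-m, by simp [hm]⟩

/-- The pairing of antisymmetric functions on oriented edges for which the edges, each taken with
one of its two orientations, are orthonormal; each edge contributes once. -/
def pairing (x y : OEdge E → ℝ) : ℝ := ∑ e : E, x (e, true) * y (e, true)

/-- The quadratic form `q` of the pairing. -/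
def quad (x : OEdge E → ℝ) : ℝ := pairing x x

/-- `r` is such that the closed `q`-balls `{x | q (x - m) ≤ r}` around the points `m` of the
lattice of integer flows cover the space of real flows. -/
def IsCoveringBound (G : MultiG V E) (r : ℝ) : Prop :=
  ∀ x ∈ G.flowSpace, ∃ m ∈ G.flowLattice, quad (x - m) ≤ r

/-- The covering number of the lattice of integer flows. -/
noncomputable def coveringNumber (G : MultiG V E) : ℝ := sInf {r : ℝ | G.IsCoveringBound r}

/-- A circuit (an orientation of a cycle), as a set of oriented edges: its oriented edges
`a 0, …, a k` are cyclically consecutive, with distinct vertices and distinct underlying edges. -/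
def IsCircuit (G : MultiG V E) (C : Finset (OEdge E)) : Prop :=
  ∃ (k : ℕ) (a : Fin (k + 1) → OEdge E),
    Function.Injective (fun i => G.tail (a i)) ∧
    Function.Injective (fun i => (a i).1) ∧
    (∀ i, G.head (a i) = G.tail (a (i + 1))) ∧
    C = Finset.univ.image a

/-- The flow `x^C` of a circuit `C`. -/
def circuitFlow (C : Finset (OEdge E)) (a : OEdge E) : ℝ :=
  if a ∈ C then 1 else if rev a ∈ C then -1 else 0

/-- `v` is the flow `v^D` of the orientation `D`: a real flow with `2⟨v, x^C⟩ = ℓ(C)` for every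
circuit `C` contained in `D`, where `ℓ(C)` is the number of edges of `C`. -/
def IsOrientationFlow (G : MultiG V E) (D : Finset (OEdge E)) (v : OEdge E → ℝ) : Prop :=
  v ∈ G.flowSpace ∧
    ∀ C : Finset (OEdge E), G.IsCircuit C → C ⊆ D → 2 * pairing v (circuitFlow C) = (C.card : ℝ)

/-- The out-degree of `y` in `D`. -/
def outDeg (G : MultiG V E) (D : Finset (OEdge E)) (y : V) : ℕ :=
  (D.filter (fun a => G.tail a = y)).card

/-- The in-degree of `y` in `D`. -/
def inDeg (G : MultiG V E) (D : Finset (OEdge E)) (y : V) : ℕ :=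
  (D.filter (fun a => G.head a = y)).card

/-- The graph Laplacian: `Δ f y` is the sum of `f y - f z` over all edges from `y` to a
neighbour `z`, with multiplicity. -/
def laplacian (G : MultiG V E) (f : V → ℝ) (y : V) : ℝ :=
  ∑ a ∈ Finset.univ.filter (fun a : OEdge E => G.tail a = y), (f y - f (G.head a))

/-- The Dirichlet energy `⟨f, Δ f⟩`, for the standard inner product on functions on vertices. -/
def energy (G : MultiG V E) (f : V → ℝ) : ℝ := ∑ y, f y * G.laplacian f y

/-- `f` solves the Laplacian equation `Δ f = d^out - d^in` of the orientation `D`. -/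
def IsPotential (G : MultiG V E) (D : Finset (OEdge E)) (f : V → ℝ) : Prop :=
  ∀ y, G.laplacian f y = (G.outDeg D y : ℝ) - (G.inDeg D y : ℝ)

/-- `D` is well-balanced: a strongly connected orientation for which `⟨f_D, Δ f_D⟩` is minimal
among all strongly connected orientations. -/
def IsWellBalanced (G : MultiG V E) (D : Finset (OEdge E)) : Prop :=
  G.IsStrongOrientation D ∧ ∃ f, G.IsPotential D f ∧
    ∀ D' f', G.IsStrongOrientation D' → G.IsPotential D' f' → G.energy f ≤ G.energy f'

/-- The graph is Eulerian: every vertex has even degree (a loop counts twice). -/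
def IsEulerian (G : MultiG V E) : Prop :=
  ∀ v, Even (Finset.univ.filter (fun a : OEdge E => G.tail a = v)).card

end Flows

end MultiG

set_option linter.unusedSectionVars false

namespace MultiG

variable {V E : Type*}

/-! In edge coordinates the flows are the orthogonal complement of the gradients of vertex
functions. Let `P` be the orthogonal projection onto flows, and let `s` range over the sign vectors,
with entries ±1 on non-bridges and 0 on bridges. Every clause is read off from the identity that the
covering number is max ‖P s‖² / 4.

Upper bound: if `m` is a lattice point nearest to `x`, comparison with `m + x^C` gives `2⟨x - m,
x^C⟩ ≤ ℓ(C)` for every circuit. These inequalities exclude negative circuits for the weight 1/2 - (x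
- m), so a feasible potential moves `x - m` by a gradient into the cube [-1/2, 1/2]^E
(`exists_grad_sub_le`). Thus `x - m` is the projection of a cube point, and convexity bounds its
norm by the value at a vertex (`exists_signVector_norm_le`).

Lower bound: for a strong orientation `D` with sign vector `s`, the flow `v^D` is `P s / 2`. It is
at least as close to 0 as to any other lattice point, because ⟨s, m⟩ ≤ ∑ |m_e| ≤ ∑ m_e² for integer
flows (`quad_le_quad_sub`).

The bounds meet because a sign vector maximizing ‖P s‖ comes from a strong orientation
(`isStrongOrientation_posPart`). Solving the Laplacian equation splits `s` into flow and gradient,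
so ‖P s‖² = ε - ⟨f, Δ f⟩, and maximal projection means minimal energy. For Eulerian graphs, half of
an everywhere odd integer flow supplies the lower bound |E|/4. -/

lemma rev_rev (a : OEdge E) : rev (rev a) = a := by simp [rev]

lemma tail_rev (G : MultiG V E) (a : OEdge E) : G.tail (rev a) = G.head a := by
  rcases a with ⟨e, _ | _⟩ <;> rfl

lemma head_rev (G : MultiG V E) (a : OEdge E) : G.head (rev a) = G.tail a := by
  rcases a with ⟨e, _ | _⟩ <;> rfl

lemma eq_or_eq_rev {a b : OEdge E} (h : a.1 = b.1) : a = b ∨ a = rev b := by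
  rcases a with ⟨e, _ | _⟩ <;> rcases b with ⟨e', _ | _⟩ <;> simp_all [rev]

/-! ### Reachability along a set of oriented edges -/

lemma Reach.mono {G : MultiG V E} {S T : Set (OEdge E)} (hST : S ⊆ T) {u v : V}
    (h : G.Reach S u v) : G.Reach T u v :=
  Relation.ReflTransGen.mono (fun _ _ ⟨a, ha, h⟩ => ⟨a, hST ha, h⟩) _ _ h

lemma Reach.symm {G : MultiG V E} {S : Set (OEdge E)} (hS : ∀ a ∈ S, rev a ∈ S) {u v : V}
    (h : G.Reach S u v) : G.Reach S v u := by
  induction h with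
  | refl => exact .refl
  | tail _ h ih =>
    obtain ⟨a, ha, h1, h2⟩ := h
    exact .head ⟨rev a, hS a ha, by rw [tail_rev, h2], by rw [head_rev, h1]⟩ ih

/-- A function that does not increase along the edges in `S` does not increase along paths. -/
lemma Reach.le_of_forall {G : MultiG V E} {S : Set (OEdge E)} {f : V → ℝ}
    (hf : ∀ a ∈ S, f (G.head a) ≤ f (G.tail a)) {u v : V} (h : G.Reach S u v) : f v ≤ f u := by
  induction h with
  | refl => exact le_rfl
  | tail _ h ih =>
    obtain ⟨a, ha, rfl, rfl⟩ := h
    exact (hf a ha).trans ih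

/-! ### Walks and the circuits inside closed walks -/

/-- The list `l` of oriented edges is a walk from `u` to `v`. -/
def IsWalk (G : MultiG V E) : V → List (OEdge E) → V → Prop
  | u, [], v => u = v
  | u, a :: l, v => G.tail a = u ∧ IsWalk G (G.head a) l v

lemma isWalk_append {G : MultiG V E} {u v : V} {l l' : List (OEdge E)} :
    G.IsWalk u (l ++ l') v ↔ ∃ w, G.IsWalk u l w ∧ G.IsWalk w l' v := by
  induction l generalizing u with
  | nil => simp [IsWalk]
  | cons a l ih => simp [IsWalk, ih, and_assoc]

lemma Reach.exists_isWalk {G : MultiG V E} {S : Set (OEdge E)} {u v : V} (h : G.Reach S u v) :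
    ∃ l, G.IsWalk u l v ∧ ∀ a ∈ l, a ∈ S := by
  induction h with
  | refl => exact ⟨[], rfl, by simp⟩
  | tail _ h ih =>
    obtain ⟨a, ha, rfl, rfl⟩ := h
    obtain ⟨l, hl, hS⟩ := ih
    refine ⟨l ++ [a], isWalk_append.2 ⟨_, hl, rfl, rfl⟩, ?_⟩
    simp only [List.mem_append, List.mem_singleton]
    rintro b (hb | rfl)
    exacts [hS b hb, ha]

lemma IsWalk.reach {G : MultiG V E} {S : Set (OEdge E)} {u v : V} {l : List (OEdge E)}
    (h : G.IsWalk u l v) (hS : ∀ a ∈ l, a ∈ S) : G.Reach S u v := by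
  induction l generalizing u with
  | nil => cases h; exact .refl
  | cons a l ih =>
    exact .head ⟨a, hS a (by simp), h.1, rfl⟩ (ih h.2 fun b hb => hS b (by simp [hb]))

lemma exists_split_of_not_nodup_map {α β : Type*} (f : α → β) {l : List α}
    (h : ¬ (l.map f).Nodup) :
    ∃ l₁ a l₂ b l₃, l = l₁ ++ (a :: l₂ ++ b :: l₃) ∧ f a = f b := by
  induction l with
  | nil => simp at h
  | cons a l ih =>
    rw [List.map_cons, List.nodup_cons, not_and_or, not_not] at h
    rcases h with h | h
    · obtain ⟨b, hb, hab⟩ := List.mem_map.1 h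
      obtain ⟨l₂, l₃, rfl⟩ := List.append_of_mem hb
      exact ⟨[], a, l₂, b, l₃, rfl, hab.symm⟩
    · obtain ⟨l₁, a', l₂, b, l₃, rfl, hab⟩ := ih h
      exact ⟨a :: l₁, a', l₂, b, l₃, rfl, hab⟩

lemma IsWalk.head_getElem {G : MultiG V E} {u v : V} {l : List (OEdge E)} (h : G.IsWalk u l v)
    (i : ℕ) (hi : i < l.length) :
    G.head l[i] = if hi' : i + 1 < l.length then G.tail l[i + 1] else v := by
  induction l generalizing u i with
  | nil => simp at hi
  | cons a l ih =>
    cases i with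
    | zero =>
      cases l with
      | nil => simpa [IsWalk] using h.2
      | cons b l => simpa using h.2.1.symm
    | succ i =>
      have := ih h.2 i (by simpa using hi)
      simpa using this

lemma IsWalk.tail_getElem_zero {G : MultiG V E} {u v : V} {l : List (OEdge E)}
    (h : G.IsWalk u l v) (hl : 0 < l.length) : G.tail l[0] = u := by
  cases l with
  | nil => simp at hl
  | cons a l => exact h.1

/-- A nonempty closed walk without repeated vertices is a circuit or goes back and forth
along one edge. -/
lemma IsWalk.isCircuit_or {G : MultiG V E} [DecidableEq E] {u : V} {l : List (OEdge E)}
    (h : G.IsWalk u l u) (hl : l ≠ []) (hn : (l.map G.tail).Nodup) :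
    G.IsCircuit l.toFinset ∨ ∃ a, l = [a, rev a] := by
  obtain ⟨k, hk⟩ : ∃ k, l.length = k + 1 :=
    Nat.exists_eq_succ_of_ne_zero (by simpa using hl)
  let a : Fin (k + 1) → OEdge E := fun i => l[(i : ℕ)]'(by omega)
  have hinj : Function.Injective (fun i => G.tail (a i)) := by
    intro i j hij
    have := (List.nodup_iff_injective_getElem.1 hn)
      (a₁ := ⟨i, by simp; omega⟩) (a₂ := ⟨j, by simp; omega⟩) (by simpa [a] using hij)
    simpa [Fin.ext_iff] using this
  have hstep : ∀ i, G.head (a i) = G.tail (a (i + 1)) := by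
    intro i
    have h1 := h.head_getElem i (by omega)
    by_cases hi : i = Fin.last k
    · subst hi
      rw [dif_neg (by simp [hk])] at h1
      rw [Fin.last_add_one]
      exact h1.trans (h.tail_getElem_zero (by omega)).symm
    · have hlt : (i : ℕ) < k := by
        have := i.2
        have : (i : ℕ) ≠ k := fun h => hi (Fin.ext h)
        omega
      rw [dif_pos (by omega)] at h1
      have hv : ((i + 1 : Fin (k + 1)) : ℕ) = i + 1 :=
        Fin.val_add_one_of_lt (Fin.lt_def.2 (by simpa using hlt))
      simp only [a, hv]
      exact h1
  have himg : l.toFinset = Finset.univ.image a := by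
    ext x
    simp only [List.mem_toFinset, Finset.mem_image, Finset.mem_univ, true_and, a]
    rw [List.mem_iff_getElem]
    exact ⟨fun ⟨i, hi, h⟩ => ⟨⟨i, by omega⟩, h⟩, fun ⟨i, h⟩ => ⟨i, by omega, h⟩⟩
  by_cases hfst : Function.Injective (fun i => (a i).1)
  · exact .inl ⟨k, a, hinj, hfst, hstep, himg⟩
  right
  simp only [Function.Injective, not_forall] at hfst
  obtain ⟨i, j, hij, hne⟩ := hfst
  -- Equal oriented edges would have equal tails, so the repeated edge is run in both directions.
  -- Each occurrence then starts where the other ends; as tails are distinct, each follows the other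
  -- cyclically, which forces length two.
  have hrev : a i = rev (a j) := by
    refine (eq_or_eq_rev hij).resolve_left fun h => hne (hinj ?_)
    simp only [h]
  have hj : j + 1 = i := hinj (by simp only [← hstep, hrev, tail_rev])
  have hi : i + 1 = j := hinj (by simp only [← hstep, hrev, head_rev])
  have hk1 : k = 1 := by
    have h2 : j + 1 + 1 = j := by rw [hj, hi]
    rw [add_assoc, add_eq_left] at h2
    have h3 := congrArg Fin.val h2
    rcases k with _ | _ | k
    · exact absurd (Fin.ext (by omega)) hne
    · rfl
    · simp [Fin.val_add, Nat.mod_eq_of_lt] at h3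
  subst hk1
  obtain ⟨b, c, rfl⟩ := List.length_eq_two.1 hk
  refine ⟨b, ?_⟩
  have h01 : a 1 = rev (a 0) := by
    fin_cases i <;> fin_cases j
    · exact absurd rfl hne
    · have : a 0 = rev (a 1) := hrev
      rw [this, rev_rev]
    · exact hrev
    · exact absurd rfl hne
  have : c = rev b := h01
  rw [this]

/-- Closed walks have nonnegative weight if circuits and pairs of opposite edges do. -/
lemma IsWalk.sum_nonneg {G : MultiG V E} [DecidableEq E] {S : Set (OEdge E)} {w : OEdge E → ℝ}
    (hrev : ∀ a ∈ S, rev a ∈ S → 0 ≤ w a + w (rev a))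
    (hC : ∀ C : Finset (OEdge E), G.IsCircuit C → ↑C ⊆ S → 0 ≤ ∑ a ∈ C, w a)
    {u : V} {l : List (OEdge E)} (h : G.IsWalk u l u) (hS : ∀ a ∈ l, a ∈ S) :
    0 ≤ (l.map w).sum := by
  induction hn : l.length using Nat.strong_induction_on generalizing l u with
  | _ n ih =>
  rcases eq_or_ne l [] with rfl | hl
  · simp
  by_cases hnd : (l.map G.tail).Nodup
  · rcases h.isCircuit_or hl hnd with hc | ⟨a, rfl⟩
    · have := hC _ hc (fun a ha => hS a (by simpa using ha))
      rwa [List.sum_toFinset _ hnd.of_map] at this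
    · simpa using hrev a (hS a (by simp)) (hS _ (by simp))
  -- Cutting at a repeated vertex leaves two shorter closed walks whose weights add up.
  · obtain ⟨l₁, a, l₂, b, l₃, rfl, hab⟩ := exists_split_of_not_nodup_map _ hnd
    obtain ⟨x, h1, h2⟩ := isWalk_append.1 h
    obtain ⟨y, h3, h4⟩ := isWalk_append.1 h2
    have hx : x = y := by rw [← h3.1, hab, h4.1]
    subst hx
    have e1 := ih (a :: l₂).length (by subst hn; simp; omega) h3
      (fun c hc => hS c (by simp at hc ⊢; tauto)) rfl
    have e2 := ih (l₁ ++ b :: l₃).length (by subst hn; simp) (isWalk_append.2 ⟨_, h1, h4⟩)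
      (fun c hc => hS c (by simp at hc ⊢; tauto)) rfl
    simp at e1 e2 ⊢
    linarith

/-! ### Feasible potentials -/

/-- Feasible potentials exist if there are no circuits of negative weight. -/
lemma exists_feasible_potential {G : MultiG V E} [Fintype V] [DecidableEq E]
    {S : Set (OEdge E)} {w : OEdge E → ℝ}
    (hsymm : ∀ u v, G.Reach S u v → G.Reach S v u)
    (hrev : ∀ a ∈ S, rev a ∈ S → 0 ≤ w a + w (rev a))
    (hC : ∀ C : Finset (OEdge E), G.IsCircuit C → ↑C ⊆ S → 0 ≤ ∑ a ∈ C, w a) :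
    ∃ f : V → ℝ, ∀ a ∈ S, f (G.head a) ≤ f (G.tail a) + w a := by
  -- The potential at `v` is the infimum of the weights of all walks in `S` ending at `v`. Leaving
  -- the start free avoids choosing a root in each component.
  let A : V → Set ℝ := fun v =>
    {c | ∃ u l, G.IsWalk u l v ∧ (∀ a ∈ l, a ∈ S) ∧ (l.map w).sum = c}
  have hne : ∀ v, (A v).Nonempty := fun v => ⟨0, v, [], rfl, by simp, by simp⟩
  have hbdd : ∀ v, BddBelow (A v) := by
    intro v
    -- One fixed return walk closes up all walks from `u` to `v`, so its weight bounds theirs from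
    -- below; finiteness of `V` makes the bound uniform.
    have hback : ∀ u, ∃ c, ∀ l, G.IsWalk u l v → (∀ a ∈ l, a ∈ S) → c ≤ (l.map w).sum := by
      intro u
      by_cases huv : G.Reach S u v
      · obtain ⟨l', hl', hS'⟩ := (hsymm _ _ huv).exists_isWalk
        refine ⟨-(l'.map w).sum, fun l hl hS => ?_⟩
        have := IsWalk.sum_nonneg hrev hC (isWalk_append.2 ⟨_, hl, hl'⟩)
          (fun a ha => (List.mem_append.1 ha).elim (hS a) (hS' a))
        simp at this
        linarith
      · exact ⟨0, fun l hl hS => absurd (hl.reach hS) huv⟩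
    choose c hc using hback
    obtain ⟨m, hm⟩ := (Set.finite_range c).bddBelow
    refine ⟨m, ?_⟩
    rintro _ ⟨u, l, hl, hS, rfl⟩
    exact (hm ⟨u, rfl⟩).trans (hc u l hl hS)
  refine ⟨fun v => sInf (A v), fun a ha => ?_⟩
  rw [← sub_le_iff_le_add]
  refine le_csInf (hne _) ?_
  rintro _ ⟨u, l, hl, hS, rfl⟩
  rw [sub_le_iff_le_add]
  refine csInf_le (hbdd _) ⟨u, l ++ [a], isWalk_append.2 ⟨_, hl, rfl, rfl⟩, ?_, by simp⟩
  simp only [List.mem_append, List.mem_singleton]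
  rintro b (hb | rfl)
  exacts [hS b hb, ha]

/-! ### Edge coordinates and gradients -/

/-- The antisymmetric function on oriented edges with given values on the reference edges. -/
def extend (y : EuclideanSpace ℝ E) (a : OEdge E) : ℝ := if a.2 then y a.1 else - y a.1

/-- The values on the reference edges. -/
def coord (x : OEdge E → ℝ) : EuclideanSpace ℝ E := WithLp.toLp 2 fun e => x (e, true)

lemma extend_rev (y : EuclideanSpace ℝ E) (a : OEdge E) : extend y (rev a) = - extend y a := by
  rcases a with ⟨e, _ | _⟩ <;> simp [extend, rev]

lemma extend_coord {x : OEdge E → ℝ} (hx : ∀ a, x (rev a) = - x a) : extend (coord x) = x := by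
  ext ⟨e, _ | _⟩
  · simpa [extend, coord, rev] using (hx (e, true)).symm
  · simp [extend, coord]

lemma coord_extend (y : EuclideanSpace ℝ E) : coord (extend y) = y := by
  ext e
  simp [extend, coord]

lemma extend_sub (x y : EuclideanSpace ℝ E) (a : OEdge E) :
    extend (x - y) a = extend x a - extend y a := by
  rcases a with ⟨e, _ | _⟩ <;> simp [extend]; ring

/-- The indicator function of a set of vertices closed under reachability. -/
lemma indicator_reach_head_le (G : MultiG V E) (S : Set (OEdge E)) (u : V) {a : OEdge E}
    (ha : a ∈ S) :
    Set.indicator {w | G.Reach S u w} (1 : V → ℝ) (G.tail a) ≤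
      Set.indicator {w | G.Reach S u w} (1 : V → ℝ) (G.head a) := by
  by_cases h : G.Reach S u (G.tail a)
  · have h' : G.Reach S u (G.head a) := .tail h ⟨a, ha, rfl, rfl⟩
    simp [h, h']
  · rw [Set.indicator_of_notMem (by exact h)]
    exact Set.indicator_nonneg (by simp) _

/-- The gradient (coboundary) of a function on vertices. -/
def grad (G : MultiG V E) : (V → ℝ) →ₗ[ℝ] EuclideanSpace ℝ E where
  toFun f := WithLp.toLp 2 fun e => f (G.fstEnd e) - f (G.sndEnd e)
  map_add' f g := by ext e; simp; ring
  map_smul' c f := by ext e; simp; ring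

lemma grad_apply (G : MultiG V E) (f : V → ℝ) (e : E) :
    G.grad f e = f (G.fstEnd e) - f (G.sndEnd e) := rfl

lemma extend_grad (G : MultiG V E) (f : V → ℝ) (a : OEdge E) :
    extend (G.grad f) a = f (G.tail a) - f (G.head a) := by
  rcases a with ⟨e, _ | _⟩ <;> simp [extend, grad, tail, head]

/-- The vector with value `1` at the edge `e` and `0` elsewhere. -/
noncomputable def edgeVec [DecidableEq E] (e : E) : EuclideanSpace ℝ E := EuclideanSpace.single e 1

lemma grad_eq_zero_iff {G : MultiG V E} (hG : G.Connected) {f : V → ℝ} :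
    G.grad f = 0 ↔ ∃ c, ∀ v, f v = c := by
  constructor
  · intro h
    obtain ⟨u⟩ := hG.1
    have hle : ∀ x y, f y ≤ f x := fun x y => (hG.2 x y).le_of_forall fun a _ => by
      have := extend_grad G f a
      rw [h] at this
      simp [extend] at this
      linarith
    exact ⟨f u, fun v => le_antisymm (hle _ _) (hle _ _)⟩
  · rintro ⟨c, hc⟩
    ext e
    simp [grad_apply, hc]

/-- A function whose gradient is the unit vector of `e` is constant along all other edges and drops
by one along `e`. This is possible exactly when deleting `e` separates its ends; the indicator of
one side is then such a function. -/
lemma edgeVec_mem_range_grad [DecidableEq E] {G : MultiG V E} {e : E} :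
    edgeVec e ∈ LinearMap.range G.grad ↔ G.IsBridge e := by
  constructor
  · rintro ⟨f, hf⟩ hr
    have hle := hr.le_of_forall (f := f) fun a ha => by
      have h1 := extend_grad G f a
      have h2 : edgeVec e a.1 = 0 := by
        simp only [edgeVec, PiLp.single_apply]
        exact if_neg ha
      rw [hf] at h1
      simp [extend, h2] at h1
      linarith
    have hle' := (hr.symm (fun a ha => ha)).le_of_forall (f := f) fun a ha => by
      have h1 := extend_grad G f a
      have h2 : edgeVec e a.1 = 0 := by
        simp only [edgeVec, PiLp.single_apply]
        exact if_neg ha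
      rw [hf] at h1
      simp [extend, h2] at h1
      linarith
    have h1 : G.grad f e = 1 := by rw [hf]; simp [edgeVec]
    rw [grad_apply] at h1
    linarith
  · intro hb
    refine ⟨Set.indicator {w | G.Reach {a | a.1 ≠ e} (G.fstEnd e) w} 1, ?_⟩
    ext e'
    rw [grad_apply]
    rcases eq_or_ne e' e with rfl | hne
    · rw [Set.indicator_of_mem (by exact .refl), Set.indicator_of_notMem (by exact hb)]
      simp [edgeVec]
    · have h1 := G.indicator_reach_head_le {a | a.1 ≠ e} (G.fstEnd e) (a := (e', true)) hne
      have h2 := G.indicator_reach_head_le {a | a.1 ≠ e} (G.fstEnd e) (a := (e', false)) hne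
      simp only [tail, head, if_true, Bool.false_eq_true, if_false] at h1 h2
      simp only [edgeVec, PiLp.single_apply, if_neg hne]
      linarith

/-! ### Divergence and the orthogonal splitting into flows and gradients -/

section Fintype

variable [Fintype E]

lemma inner_eq_sum (x y : EuclideanSpace ℝ E) : inner ℝ x y = ∑ e, x e * y e := by
  simp [PiLp.inner_apply, mul_comm]

lemma pairing_eq_inner (x y : OEdge E → ℝ) : pairing x y = inner ℝ (coord x) (coord y) := by
  rw [inner_eq_sum]; rfl

lemma quad_eq_norm_sq (x : OEdge E → ℝ) : quad x = ‖coord x‖ ^ 2 := by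
  rw [quad, pairing_eq_inner, real_inner_self_eq_norm_sq]

lemma norm_sq_eq_sum (x : EuclideanSpace ℝ E) : ‖x‖ ^ 2 = ∑ e, x e ^ 2 := by
  rw [← real_inner_self_eq_norm_sq, inner_eq_sum]
  simp [sq]

lemma sum_oedge (g : OEdge E → ℝ) : ∑ a, g a = ∑ e, (g (e, true) + g (e, false)) := by
  simp [Fintype.sum_prod_type]

variable [Fintype V] [DecidableEq V]

/-- The net flow out of a vertex. -/
def divergence (G : MultiG V E) (y : EuclideanSpace ℝ E) (v : V) : ℝ :=
  ∑ a ∈ Finset.univ.filter (fun a => G.tail a = v), extend y a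

/-- Summation by parts: each edge contributes to the divergence once at either end, with opposite
signs. -/
lemma inner_grad_left (G : MultiG V E) (f : V → ℝ) (y : EuclideanSpace ℝ E) :
    inner ℝ (G.grad f) y = ∑ v, f v * G.divergence y v := by
  have h : ∀ v, f v * G.divergence y v =
      ∑ a ∈ Finset.univ.filter (fun a => G.tail a = v), f (G.tail a) * extend y a := by
    intro v
    rw [divergence, Finset.mul_sum]
    refine Finset.sum_congr rfl fun a ha => ?_
    rw [(Finset.mem_filter.1 ha).2]
  simp only [h]
  rw [Finset.sum_fiberwise, sum_oedge, inner_eq_sum]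
  refine Finset.sum_congr rfl fun e _ => ?_
  simp [grad_apply, extend, tail]
  ring

lemma laplacian_eq_divergence (G : MultiG V E) (f : V → ℝ) (v : V) :
    G.laplacian f v = G.divergence (G.grad f) v := by
  refine Finset.sum_congr rfl fun a ha => ?_
  rw [extend_grad, (Finset.mem_filter.1 ha).2]

lemma energy_eq_norm_sq (G : MultiG V E) (f : V → ℝ) : G.energy f = ‖G.grad f‖ ^ 2 := by
  rw [← real_inner_self_eq_norm_sq, inner_grad_left]
  simp [energy, laplacian_eq_divergence]

/-- The space of flows, in coordinates. -/
noncomputable abbrev flows (G : MultiG V E) : Submodule ℝ (EuclideanSpace ℝ E) := (LinearMap.range G.grad)ᗮ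

lemma mem_flows_iff_inner {G : MultiG V E} {y : EuclideanSpace ℝ E} :
    y ∈ G.flows ↔ ∀ f, inner ℝ (G.grad f) y = 0 := by
  simp [flows, Submodule.mem_orthogonal]

lemma mem_flows_iff {G : MultiG V E} {y : EuclideanSpace ℝ E} :
    y ∈ G.flows ↔ ∀ v, G.divergence y v = 0 := by
  rw [mem_flows_iff_inner]
  constructor
  · intro h v
    have := h (Pi.single v 1)
    rw [inner_grad_left] at this
    simpa [Pi.single_apply] using this
  · intro h f
    simp [inner_grad_left, h]

variable [DecidableEq E]

lemma extend_mem_flowSpace {G : MultiG V E} {y : EuclideanSpace ℝ E} :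
    extend y ∈ G.flowSpace ↔ y ∈ G.flows := by
  rw [mem_flows_iff]
  exact ⟨fun h => h.2, fun h => ⟨extend_rev y, h⟩⟩

lemma coord_mem_flows {G : MultiG V E} {x : OEdge E → ℝ} (hx : x ∈ G.flowSpace) :
    coord x ∈ G.flows := by
  rw [← extend_mem_flowSpace, extend_coord hx.1]
  exact hx

/-- The orthogonal projection onto the space of flows. -/
noncomputable abbrev proj (G : MultiG V E) : EuclideanSpace ℝ E →L[ℝ] EuclideanSpace ℝ E :=
  G.flows.starProjection

lemma proj_mem (G : MultiG V E) (y : EuclideanSpace ℝ E) : G.proj y ∈ G.flows :=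
  Submodule.starProjection_apply_mem _ _

lemma proj_eq_zero_iff {G : MultiG V E} {y : EuclideanSpace ℝ E} :
    G.proj y = 0 ↔ y ∈ LinearMap.range G.grad := by
  rw [Submodule.starProjection_apply_eq_zero_iff, Submodule.orthogonal_orthogonal]

lemma proj_grad (G : MultiG V E) (f : V → ℝ) : G.proj (G.grad f) = 0 :=
  proj_eq_zero_iff.2 ⟨f, rfl⟩

lemma proj_of_mem {G : MultiG V E} {y : EuclideanSpace ℝ E} (h : y ∈ G.flows) : G.proj y = y :=
  Submodule.starProjection_eq_self_iff.2 h

lemma inner_proj_right (G : MultiG V E) (x y : EuclideanSpace ℝ E) :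
    inner ℝ x (G.proj y) = inner ℝ (G.proj x) y :=
  (Submodule.inner_starProjection_left_eq_right _ _ _).symm

lemma inner_proj_of_mem {G : MultiG V E} {y : EuclideanSpace ℝ E} (h : y ∈ G.flows)
    (x : EuclideanSpace ℝ E) : inner ℝ (G.proj x) y = inner ℝ x y := by
  rw [← inner_proj_right, proj_of_mem h]

lemma exists_sub_grad_mem_flows (G : MultiG V E) (y : EuclideanSpace ℝ E) :
    ∃ f, y - G.grad f ∈ G.flows := by
  have h : y - G.proj y ∈ LinearMap.range G.grad := by
    rw [← proj_eq_zero_iff, map_sub, proj_of_mem (G.proj_mem y), sub_self]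
  obtain ⟨f, hf⟩ := h
  exact ⟨f, by rw [hf, sub_sub_cancel]; exact G.proj_mem y⟩

/-- Pythagoras for `y = (y - grad f) + grad f`, whose first summand is the projection of `y`. -/
lemma norm_proj_sq_of_sub_mem {G : MultiG V E} {y : EuclideanSpace ℝ E} {f : V → ℝ}
    (h : y - G.grad f ∈ G.flows) : ‖G.proj y‖ ^ 2 = ‖y‖ ^ 2 - ‖G.grad f‖ ^ 2 := by
  have h1 : G.proj y = y - G.grad f := by
    rw [← proj_of_mem h, map_sub, proj_grad, sub_zero]
  have h2 : inner ℝ (G.grad f) (y - G.grad f) = 0 := mem_flows_iff_inner.1 h f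
  have h3 := norm_add_sq_eq_norm_sq_add_norm_sq_real h2
  rw [add_sub_cancel] at h3
  rw [h1]
  nlinarith

lemma proj_edgeVec_eq_zero_iff {G : MultiG V E} {e : E} :
    G.proj (edgeVec e) = 0 ↔ G.IsBridge e := by
  rw [proj_eq_zero_iff, edgeVec_mem_range_grad]

lemma eq_sum_edgeVec (y : EuclideanSpace ℝ E) : y = ∑ e, y e • edgeVec e := by
  ext e
  simp [edgeVec, Pi.single_apply]

/-- The projection does not depend on the values on bridges. -/
lemma proj_congr {G : MultiG V E} {x y : EuclideanSpace ℝ E}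
    (h : ∀ e, ¬ G.IsBridge e → x e = y e) : G.proj x = G.proj y := by
  rw [← sub_eq_zero, ← map_sub, eq_sum_edgeVec (x - y), map_sum]
  refine Finset.sum_eq_zero fun e _ => ?_
  rw [map_smul]
  by_cases he : G.IsBridge e
  · rw [proj_edgeVec_eq_zero_iff.2 he, smul_zero]
  · simp [h e he]

end Fintype

/-! ### Circuit flows as lattice vectors -/

section Circuits

variable [Fintype V] [DecidableEq V] [Fintype E] [DecidableEq E]

lemma IsCircuit.rev_notMem {G : MultiG V E} {C : Finset (OEdge E)} (hC : G.IsCircuit C)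
    {a : OEdge E} (ha : a ∈ C) : rev a ∉ C := by
  obtain ⟨k, b, -, hfst, -, rfl⟩ := hC
  simp only [Finset.mem_image, Finset.mem_univ, true_and] at ha ⊢
  rintro ⟨j, hj⟩
  obtain ⟨i, rfl⟩ := ha
  have : j = i := hfst (by simp only [hj]; rfl)
  subst this
  have := congrArg Prod.snd hj
  simp [rev] at this

lemma IsCircuit.circuitFlow_rev {G : MultiG V E} {C : Finset (OEdge E)} (hC : G.IsCircuit C)
    (a : OEdge E) : circuitFlow C (rev a) = - circuitFlow C a := by
  simp only [circuitFlow, rev_rev]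
  by_cases h : a ∈ C
  · simp [h, hC.rev_notMem h]
  · by_cases h' : rev a ∈ C <;> simp [h, h']

/-- A circuit contains at most one orientation of each edge, so the signs of its flow are absorbed
by the antisymmetry of `extend y`. -/
lemma IsCircuit.inner_coord {G : MultiG V E} {C : Finset (OEdge E)} (hC : G.IsCircuit C)
    (y : EuclideanSpace ℝ E) : inner ℝ y (coord (circuitFlow C)) = ∑ a ∈ C, extend y a := by
  have h : ∑ a ∈ C, extend y a = ∑ a, if a ∈ C then extend y a else 0 := by simp
  rw [h, sum_oedge, inner_eq_sum]
  refine Finset.sum_congr rfl fun e _ => ?_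
  have h1 : (e, true) ∈ C → (e, false) ∉ C := fun h => hC.rev_notMem h
  simp only [coord, circuitFlow, extend, rev, Bool.not_true]
  split_ifs <;> simp_all

lemma IsCircuit.coord_mem_flows {G : MultiG V E} {C : Finset (OEdge E)} (hC : G.IsCircuit C) :
    coord (circuitFlow C) ∈ G.flows := by
  rw [mem_flows_iff_inner]
  intro f
  rw [hC.inner_coord]
  obtain ⟨k, b, htail, hfst, hstep, rfl⟩ := hC
  rw [Finset.sum_image fun i _ j _ h => hfst (by simp only [h])]
  simp only [extend_grad, hstep, Finset.sum_sub_distrib]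
  rw [sub_eq_zero]
  -- Heads are the tails shifted by one place around the circuit, so the gradient telescopes to
  -- zero.
  exact (Equiv.sum_comp (Equiv.addRight (1 : Fin (k + 1))) fun i => f (G.tail (b i))).symm

lemma IsCircuit.circuitFlow_mem_flowLattice {G : MultiG V E} {C : Finset (OEdge E)}
    (hC : G.IsCircuit C) : circuitFlow C ∈ G.flowLattice := by
  refine ⟨?_, fun a => ?_⟩
  · rw [← extend_coord hC.circuitFlow_rev, extend_mem_flowSpace]
    exact hC.coord_mem_flows
  · rw [circuitFlow]
    split_ifs
    exacts [⟨1, by simp⟩, ⟨-1, by simp⟩, ⟨0, by simp⟩]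

lemma IsCircuit.quad_circuitFlow {G : MultiG V E} {C : Finset (OEdge E)} (hC : G.IsCircuit C) :
    quad (circuitFlow C) = C.card := by
  rw [quad, pairing_eq_inner, hC.inner_coord, extend_coord hC.circuitFlow_rev,
    Finset.card_eq_sum_ones, Nat.cast_sum]
  exact Finset.sum_congr rfl fun a ha => by simp [circuitFlow, ha]

end Circuits

variable [Fintype V] [DecidableEq V] [Fintype E] [DecidableEq E]

/-! ### Sign vectors of orientations and the Laplacian equation -/

/-- The signed indicator of a set of oriented edges. -/
noncomputable def signVec (D : Finset (OEdge E)) : EuclideanSpace ℝ E :=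
  WithLp.toLp 2 fun e => (if (e, true) ∈ D then 1 else 0) - (if (e, false) ∈ D then 1 else 0)

lemma extend_signVec (D : Finset (OEdge E)) (a : OEdge E) :
    extend (signVec D) a = (if a ∈ D then 1 else 0) - (if rev a ∈ D then 1 else 0) := by
  rcases a with ⟨e, _ | _⟩ <;> simp [extend, signVec, rev]

lemma divergence_signVec (G : MultiG V E) (D : Finset (OEdge E)) (v : V) :
    G.divergence (signVec D) v = (G.outDeg D v : ℝ) - (G.inDeg D v : ℝ) := by
  have hout : ∑ a ∈ Finset.univ.filter (fun a => G.tail a = v), (if a ∈ D then (1 : ℝ) else 0) =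
      G.outDeg D v := by
    rw [Finset.sum_boole, outDeg, Finset.filter_filter]
    congr 2
    ext a
    simp [and_comm]
  have hin : ∑ a ∈ Finset.univ.filter (fun a => G.tail a = v), (if rev a ∈ D then (1 : ℝ) else 0) =
      G.inDeg D v := by
    rw [Finset.sum_boole, inDeg, Finset.filter_filter]
    congr 1
    refine Finset.card_bij (fun a _ => rev a) ?_ ?_ ?_
    · intro a ha
      simp only [Finset.mem_filter, Finset.mem_univ, true_and] at ha ⊢
      exact ⟨ha.2, by rw [head_rev, ha.1]⟩
    · intro a _ b _ h
      rw [← rev_rev a, h, rev_rev]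
    · intro a ha
      rw [Finset.mem_filter] at ha
      exact ⟨rev a, by simp [rev_rev, tail_rev, ha.1, ha.2], rev_rev a⟩
  simp only [divergence, extend_signVec, Finset.sum_sub_distrib, hout, hin]

/-- The right side of the equation is the divergence of the sign vector and the left side that of
the gradient, so solving it amounts to splitting the sign vector orthogonally. -/
lemma isPotential_iff {G : MultiG V E} {D : Finset (OEdge E)} {f : V → ℝ} :
    G.IsPotential D f ↔ signVec D - G.grad f ∈ G.flows := by
  rw [mem_flows_iff]
  refine forall_congr' fun v => ?_
  rw [laplacian_eq_divergence, ← divergence_signVec]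
  simp only [divergence, extend_sub, Finset.sum_sub_distrib]
  rw [sub_eq_zero, eq_comm]

lemma exists_isPotential (G : MultiG V E) (D : Finset (OEdge E)) : ∃ f, G.IsPotential D f :=
  (G.exists_sub_grad_mem_flows (signVec D)).imp fun _ => isPotential_iff.2

/-- The difference of the gradients is both a gradient and a flow, hence orthogonal to itself. -/
lemma IsPotential.grad_eq {G : MultiG V E} {D : Finset (OEdge E)} {f f' : V → ℝ}
    (hf : G.IsPotential D f) (hf' : G.IsPotential D f') : G.grad f = G.grad f' := by
  rw [isPotential_iff] at hf hf'
  have h := G.flows.sub_mem hf hf'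
  rw [sub_sub_sub_cancel_left, ← map_sub] at h
  have h0 := mem_flows_iff_inner.1 h (f' - f)
  rw [inner_self_eq_zero, map_sub, sub_eq_zero] at h0
  exact h0.symm

lemma IsPotential.energy_eq {G : MultiG V E} {D : Finset (OEdge E)} {f f' : V → ℝ}
    (hf : G.IsPotential D f) (hf' : G.IsPotential D f') : G.energy f = G.energy f' := by
  rw [energy_eq_norm_sq, energy_eq_norm_sq, hf.grad_eq hf']

lemma IsPotential.exists_eq_add {G : MultiG V E} (hG : G.Connected) {D : Finset (OEdge E)}
    {f f' : V → ℝ} (hf : G.IsPotential D f) (hf' : G.IsPotential D f') :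
    ∃ c : ℝ, ∀ y, f' y = f y + c := by
  have h : G.grad (f' - f) = 0 := by rw [map_sub, hf.grad_eq hf', sub_self]
  obtain ⟨c, hc⟩ := (grad_eq_zero_iff hG).1 h
  exact ⟨c, fun y => by have := hc y; simp at this; linarith⟩

/-! ### The flow of a strongly connected orientation -/

namespace IsStrongOrientation

variable {G : MultiG V E} {D : Finset (OEdge E)}

lemma rev_notMem (hD : G.IsStrongOrientation D) {a : OEdge E} (ha : a ∈ D) : rev a ∉ D := by
  have h := hD.exactly_one a.1 (hD.not_bridge a ha)
  rcases a with ⟨e, _ | _⟩ <;> simp_all [Xor, rev]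

lemma extend_signVec_of_mem (hD : G.IsStrongOrientation D) {a : OEdge E} (ha : a ∈ D) :
    extend (signVec D) a = 1 := by
  simp [extend_signVec, ha, hD.rev_notMem ha]

lemma signVec_apply_of_isBridge (hD : G.IsStrongOrientation D) {e : E} (he : G.IsBridge e) :
    signVec D e = 0 := by
  have h1 : (e, true) ∉ D := fun h => hD.not_bridge _ h he
  have h2 : (e, false) ∉ D := fun h => hD.not_bridge _ h he
  simp [signVec, h1, h2]

lemma signVec_apply_of_not_isBridge (hD : G.IsStrongOrientation D) {e : E}
    (he : ¬ G.IsBridge e) : signVec D e = 1 ∨ signVec D e = -1 := by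
  rcases hD.exactly_one e he with ⟨h1, h2⟩ | ⟨h1, h2⟩ <;> simp [signVec, h1, h2]

lemma norm_signVec_sq (hD : G.IsStrongOrientation D) : ‖signVec D‖ ^ 2 = G.numNonBridge := by
  classical
  have h : ∀ e, signVec D e ^ 2 = if ¬ G.IsBridge e then 1 else 0 := by
    intro e
    by_cases he : G.IsBridge e
    · simp [he, hD.signVec_apply_of_isBridge he]
    · rcases hD.signVec_apply_of_not_isBridge he with h | h <;> simp [h, he]
  simp only [norm_sq_eq_sum, h]
  rw [Finset.sum_boole, numNonBridge, Nat.card_eq_fintype_card, Fintype.card_subtype]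

lemma reach_symm (hD : G.IsStrongOrientation D) {u v : V} (h : G.Reach (↑D) u v) :
    G.Reach (↑D) v u := by
  refine hD.strong _ _ (Reach.symm (fun a ha => ha) (h.mono fun a ha => ?_))
  exact hD.not_bridge a ha

/-- Circuit flows are fixed by the projection, so pairing with one sees the sign vector itself,
which is 1 on every oriented edge of a circuit in `D`. -/
lemma isOrientationFlow (hD : G.IsStrongOrientation D) :
    G.IsOrientationFlow D (extend ((1 / 2 : ℝ) • G.proj (signVec D))) := by
  refine ⟨extend_mem_flowSpace.2 (G.flows.smul_mem _ (G.proj_mem _)), fun C hC hCD => ?_⟩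
  rw [pairing_eq_inner, coord_extend, inner_smul_left, inner_proj_of_mem hC.coord_mem_flows,
    hC.inner_coord, Finset.sum_congr rfl fun a ha => hD.extend_signVec_of_mem (hCD ha)]
  simp

/-- A flow orthogonal to all circuits of a strongly connected orientation vanishes. -/
lemma eq_zero_of_forall_circuit (hD : G.IsStrongOrientation D) {y : EuclideanSpace ℝ E}
    (hy : y ∈ G.flows)
    (h : ∀ C, G.IsCircuit C → C ⊆ D → inner ℝ y (coord (circuitFlow C)) = 0) : y = 0 := by
  have hpot : ∀ z : EuclideanSpace ℝ E, (z = y ∨ z = -y) →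
      ∃ f : V → ℝ, ∀ a ∈ (D : Set (OEdge E)), f (G.head a) ≤ f (G.tail a) + extend z a := by
    intro z hz
    refine exists_feasible_potential (fun u v => hD.reach_symm)
      (fun a ha ha' => absurd ha' (hD.rev_notMem ha)) fun C hC hCD => ?_
    have h0 := h C hC hCD
    rw [← hC.inner_coord]
    rcases hz with rfl | rfl
    · exact h0.ge
    · rw [inner_neg_left, h0, neg_zero]
  obtain ⟨f, hf⟩ := hpot y (.inl rfl)
  obtain ⟨g, hg⟩ := hpot (-y) (.inr rfl)
  have hneg : ∀ a, extend (-y) a = - extend y a := by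
    rintro ⟨e, _ | _⟩ <;> simp [extend]
  simp only [hneg] at hg
  have hfg : ∀ a ∈ (D : Set (OEdge E)), (f + g) (G.head a) ≤ (f + g) (G.tail a) := by
    intro a ha
    have h1 := hf a ha
    have h2 := hg a ha
    simp only [Pi.add_apply]
    linarith
  -- `f + g` does not increase along `D`, and `D` leads back from the head of each of its edges to
  -- the tail; hence both potential inequalities are equalities.
  have heq : ∀ a ∈ D, extend y a = - extend (G.grad f) a := by
    intro a ha
    have h1 := hf a ha
    have h2 := hg a ha
    have h3 := (hD.reach_symm (.single ⟨a, ha, rfl, rfl⟩)).le_of_forall hfg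
    simp only [Pi.add_apply] at h3
    rw [extend_grad]
    linarith
  have hedge : ∀ e, ¬ G.IsBridge e → y e = - G.grad f e := by
    intro e he
    rcases hD.exactly_one e he with ⟨h1, -⟩ | ⟨h1, -⟩
    · simpa [extend] using heq _ h1
    · have := heq _ h1
      simp [extend] at this
      linarith
  -- Off the bridges `y` is a gradient; the projection fixes `y`, ignores bridges and kills
  -- gradients.
  rw [← proj_of_mem hy, proj_congr (y := G.grad (-f)), proj_grad]
  intro e he
  rw [hedge e he, map_neg]
  rfl

lemma eq_of_isOrientationFlow (hD : G.IsStrongOrientation D) {v : OEdge E → ℝ}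
    (hv : G.IsOrientationFlow D v) : coord v = (1 / 2 : ℝ) • G.proj (signVec D) := by
  have h0 := hD.isOrientationFlow
  rw [← sub_eq_zero]
  refine hD.eq_zero_of_forall_circuit (G.flows.sub_mem (coord_mem_flows hv.1)
    (G.flows.smul_mem _ (G.proj_mem _))) fun C hC hCD => ?_
  have h1 := hv.2 C hC hCD
  have h2 := h0.2 C hC hCD
  rw [pairing_eq_inner] at h1 h2
  rw [coord_extend] at h2
  rw [inner_sub_left]
  linarith

lemma existsUnique_isOrientationFlow (hD : G.IsStrongOrientation D) :
    ∃! v, G.IsOrientationFlow D v := by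
  refine ⟨_, hD.isOrientationFlow, fun v hv => ?_⟩
  rw [← extend_coord hv.1.1, hD.eq_of_isOrientationFlow hv]

lemma quad_eq_of_isOrientationFlow (hD : G.IsStrongOrientation D) {v : OEdge E → ℝ}
    (hv : G.IsOrientationFlow D v) : quad v = ‖G.proj (signVec D)‖ ^ 2 / 4 := by
  rw [quad_eq_norm_sq, hD.eq_of_isOrientationFlow hv, norm_smul]
  norm_num
  ring

/-- All strong orientations have sign vectors of the same norm, so this turns maximal projection
into minimal energy. -/
lemma norm_proj_signVec_sq (hD : G.IsStrongOrientation D) {f : V → ℝ} (hf : G.IsPotential D f) :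
    ‖G.proj (signVec D)‖ ^ 2 = G.numNonBridge - G.energy f := by
  rw [norm_proj_sq_of_sub_mem (isPotential_iff.1 hf), hD.norm_signVec_sq, energy_eq_norm_sq]

end IsStrongOrientation

/-! ### Maximal sign vectors are strongly connected orientations -/

open Classical in
/-- The vectors with entries `1` or `-1` on edges that are not bridges, and `0` on bridges. -/
def signVectors (G : MultiG V E) : Set (E → ℝ) :=
  Set.pi Set.univ fun e => if G.IsBridge e then {0} else {-1, 1}

lemma mem_signVectors {G : MultiG V E} {s : E → ℝ} :
    s ∈ G.signVectors ↔
      ∀ e, (G.IsBridge e → s e = 0) ∧ (¬ G.IsBridge e → s e = -1 ∨ s e = 1) := by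
  simp only [signVectors, Set.mem_univ_pi]
  refine forall_congr' fun e => ?_
  by_cases he : G.IsBridge e <;> simp [he]

lemma IsStrongOrientation.signVec_mem {G : MultiG V E} {D : Finset (OEdge E)}
    (hD : G.IsStrongOrientation D) : (signVec D).ofLp ∈ G.signVectors :=
  mem_signVectors.2 fun _ =>
    ⟨hD.signVec_apply_of_isBridge, fun he => (hD.signVec_apply_of_not_isBridge he).symm⟩

lemma exists_maximal_signVector (G : MultiG V E) :
    ∃ s ∈ G.signVectors, ∀ t ∈ G.signVectors,
      ‖G.proj (WithLp.toLp 2 t)‖ ≤ ‖G.proj (WithLp.toLp 2 s)‖ := by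
  classical
  refine Set.exists_max_image G.signVectors (fun t => ‖G.proj (WithLp.toLp 2 t)‖) ?_ ?_
  · refine Set.Finite.pi fun e => ?_
    split_ifs <;> simp
  · refine Set.univ_pi_nonempty_iff.2 fun e => ?_
    split_ifs <;> simp

/-- A convex function on a cube is bounded by its values at the vertices. -/
lemma exists_signVector_norm_le (G : MultiG V E) {y : EuclideanSpace ℝ E} (hy : ∀ e, |y e| ≤ 1) :
    ∃ t ∈ G.signVectors, ‖G.proj y‖ ≤ ‖G.proj (WithLp.toLp 2 t)‖ := by
  classical
  -- Clearing the bridge coordinates does not change the projection and puts the point into the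
  -- convex hull of the sign vectors.
  let z : E → ℝ := fun e => if G.IsBridge e then 0 else y e
  have hz : z ∈ convexHull ℝ G.signVectors := by
    rw [signVectors, convexHull_pi, Set.mem_univ_pi]
    intro e
    by_cases he : G.IsBridge e
    · simp [z, he]
    · simp only [z, he, if_false]
      rw [convexHull_pair, segment_eq_Icc (by norm_num)]
      exact abs_le.1 (hy e)
  have hconv : ConvexOn ℝ (convexHull ℝ G.signVectors)
      fun t : E → ℝ => ‖G.proj (WithLp.toLp 2 t)‖ :=
    ((convexOn_norm (E := EuclideanSpace ℝ E) convex_univ).comp_linearMap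
      (G.proj.toLinearMap ∘ₗ (WithLp.linearEquiv 2 ℝ (E → ℝ)).symm.toLinearMap)).subset
      (Set.subset_univ _) (convex_convexHull ℝ _)
  obtain ⟨t, ht, hle⟩ := hconv.exists_ge_of_mem_convexHull (subset_convexHull ℝ _) hz
  refine ⟨t, ht, ?_⟩
  rwa [← proj_congr (x := WithLp.toLp 2 z) (y := y)]
  intro e he
  simp [z, he]

/-- Flipping one edge does not increase the projected norm of a maximal sign vector. -/
lemma norm_proj_edgeVec_sq_le {G : MultiG V E} {s : E → ℝ} (hs : s ∈ G.signVectors)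
    (hmax : ∀ t ∈ G.signVectors, ‖G.proj (WithLp.toLp 2 t)‖ ≤ ‖G.proj (WithLp.toLp 2 s)‖)
    {e : E} (he : ¬ G.IsBridge e) :
    ‖G.proj (edgeVec e)‖ ^ 2 ≤
      s e * inner ℝ (G.proj (WithLp.toLp 2 s)) (G.proj (edgeVec e)) := by
  have hse := (mem_signVectors.1 hs e).2 he
  have hflip : Function.update s e (- s e) ∈ G.signVectors := by
    rw [mem_signVectors]
    intro e'
    rcases eq_or_ne e' e with rfl | hne
    · refine ⟨fun h => absurd h he, fun _ => ?_⟩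
      rcases hse with h | h <;> simp [h]
    · simpa [hne] using mem_signVectors.1 hs e'
  have heq : WithLp.toLp 2 (Function.update s e (- s e)) =
      WithLp.toLp 2 s - (2 * s e) • edgeVec e := by
    ext e'
    rcases eq_or_ne e' e with rfl | hne
    · simp [edgeVec]; ring
    · simp [edgeVec, hne]
  have hsq : s e ^ 2 = 1 := by rcases hse with h | h <;> simp [h]
  -- Expanding the square after the flip leaves 4‖P e‖² ≤ 4 s_e ⟨P s, P e⟩, since s_e² = 1.
  have h1 := pow_le_pow_left₀ (norm_nonneg _) (hmax _ hflip) 2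
  rw [heq, map_sub, map_smul, norm_sub_sq_real, inner_smul_right, norm_smul, mul_pow,
    Real.norm_eq_abs, sq_abs, mul_pow, hsq] at h1
  linarith

/-- The orientation of the edges that are not bridges according to a sign vector. -/
noncomputable def posPart (s : E → ℝ) : Finset (OEdge E) :=
  Finset.univ.filter fun a => extend (WithLp.toLp 2 s) a = 1

lemma signVec_posPart {G : MultiG V E} {s : E → ℝ} (hs : s ∈ G.signVectors) :
    signVec (posPart s) = WithLp.toLp 2 s := by
  ext e
  by_cases he : G.IsBridge e
  · have := (mem_signVectors.1 hs e).1 he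
    simp [signVec, posPart, extend, this]
  · rcases (mem_signVectors.1 hs e).2 he with h | h <;>
      norm_num [signVec, posPart, extend, h]

/-- Suppose `v` cannot be reached from `u`. Every oriented edge across the boundary of the set
reachable from `u` points into that set. By the flip inequality each non-bridge of this cut has a
positive s_e ⟨P s, P e⟩, yet these terms add up, to within sign, to the pairing of P s with the
projection of a gradient, which is zero. So the cut consists of bridges, although `u` and `v` are
connected without bridges. -/
lemma isStrongOrientation_posPart {G : MultiG V E} {s : E → ℝ} (hs : s ∈ G.signVectors)
    (hmax : ∀ t ∈ G.signVectors, ‖G.proj (WithLp.toLp 2 t)‖ ≤ ‖G.proj (WithLp.toLp 2 s)‖) :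
    G.IsStrongOrientation (posPart s) where
  not_bridge := by
    rintro ⟨e, b⟩ ha he
    have := (mem_signVectors.1 hs e).1 he
    simp [posPart, extend, this] at ha
  exactly_one e he := by
    rcases (mem_signVectors.1 hs e).2 he with h | h <;>
      norm_num [Xor, posPart, extend, h]
  strong u v huv := by
    by_contra hnot
    set D : Finset (OEdge E) := posPart s with hDdef
    let g : V → ℝ := Set.indicator {w | G.Reach (↑D) u w} 1
    have hmono : ∀ a ∈ D, g (G.tail a) ≤ g (G.head a) := fun a ha =>
      G.indicator_reach_head_le (↑D) u ha
    have hsgn : ∀ e, ¬ G.IsBridge e → 0 ≤ - (s e * G.grad g e) := by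
      intro e he
      rcases (mem_signVectors.1 hs e).2 he with h | h
      · have := hmono (e, false) (by simp [hDdef, posPart, extend, h])
        simp [tail, head] at this
        rw [grad_apply, h]
        linarith
      · have := hmono (e, true) (by simp [hDdef, posPart, extend, h])
        simp [tail, head] at this
        rw [grad_apply, h]
        linarith
    have hle : ∀ e, - (s e * G.grad g e) * ‖G.proj (edgeVec e)‖ ^ 2 ≤
        - (G.grad g e * inner ℝ (G.proj (WithLp.toLp 2 s)) (G.proj (edgeVec e))) := by
      intro e
      by_cases he : G.IsBridge e
      · simp [proj_edgeVec_eq_zero_iff.2 he]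
      · have h1 := mul_le_mul_of_nonneg_left (norm_proj_edgeVec_sq_le hs hmax he) (hsgn e he)
        have hsq : s e ^ 2 = 1 := by
          rcases (mem_signVectors.1 hs e).2 he with h | h <;> simp [h]
        refine h1.trans_eq ?_
        linear_combination (- G.grad g e *
          inner ℝ (G.proj (WithLp.toLp 2 s)) (G.proj (edgeVec e))) * hsq
    have hnonneg : ∀ e, 0 ≤ - (s e * G.grad g e) * ‖G.proj (edgeVec e)‖ ^ 2 := by
      intro e
      by_cases he : G.IsBridge e
      · simp [proj_edgeVec_eq_zero_iff.2 he]
      · exact mul_nonneg (hsgn e he) (sq_nonneg _)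
    -- This is the pairing of P s with P (grad g) = 0, expanded over the edges.
    have hsum : ∑ e, G.grad g e * inner ℝ (G.proj (WithLp.toLp 2 s)) (G.proj (edgeVec e)) = 0 := by
      have h := congrArg (fun z => inner ℝ (G.proj (WithLp.toLp 2 s)) z) (G.proj_grad g)
      rw [eq_sum_edgeVec (G.grad g)] at h
      simpa [map_sum, inner_sum, inner_smul_right] using h
    have hzero : ∑ e, - (s e * G.grad g e) * ‖G.proj (edgeVec e)‖ ^ 2 = 0 := by
      refine le_antisymm ?_ (Finset.sum_nonneg fun e _ => hnonneg e)
      refine (Finset.sum_le_sum fun e _ => hle e).trans ?_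
      rw [Finset.sum_neg_distrib, hsum, neg_zero]
    have hgrad : ∀ e, ¬ G.IsBridge e → G.grad g e = 0 := by
      intro e he
      have h0 := (Finset.sum_eq_zero_iff_of_nonneg fun e _ => hnonneg e).1 hzero e (Finset.mem_univ _)
      have hne : ‖G.proj (edgeVec e)‖ ^ 2 ≠ 0 := by
        simpa using fun h => he (proj_edgeVec_eq_zero_iff.1 h)
      have hs0 : s e ≠ 0 := by
        rcases (mem_signVectors.1 hs e).2 he with h | h <;> simp [h]
      exact (mul_eq_zero.1 (neg_eq_zero.1 ((mul_eq_zero.1 h0).resolve_right hne))).resolve_left hs0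
    have hvu := (huv.symm fun a ha => ha).le_of_forall (f := g) fun a ha => by
      have h1 := extend_grad G g a
      simp [extend, hgrad a.1 ha] at h1
      linarith
    have hgu : g u = 1 := Set.indicator_of_mem (by exact .refl) _
    have hgv : g v = 0 := Set.indicator_of_notMem (by exact hnot) _
    linarith

/-- A strongly connected orientation whose projected sign vector has maximal norm. -/
lemma exists_maximal_isStrongOrientation (G : MultiG V E) :
    ∃ D, G.IsStrongOrientation D ∧ ∀ t ∈ G.signVectors,
      ‖G.proj (WithLp.toLp 2 t)‖ ≤ ‖G.proj (signVec D)‖ := by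
  obtain ⟨s, hs, hmax⟩ := G.exists_maximal_signVector
  refine ⟨posPart s, isStrongOrientation_posPart hs hmax, ?_⟩
  rwa [signVec_posPart hs]

/-! ### Nearest lattice points and the two bounds -/

lemma exists_int_of_mem_flowLattice {G : MultiG V E} {m : OEdge E → ℝ} (hm : m ∈ G.flowLattice) :
    ∃ n : E → ℤ, ∀ e, coord m e = n e := by
  choose n hn using hm.2
  exact ⟨fun e => n (e, true), fun e => hn _⟩

/-- Every point has a nearest lattice point. -/
lemma exists_nearest_lattice_point (G : MultiG V E) (x : OEdge E → ℝ) :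
    ∃ m ∈ G.flowLattice, ∀ m' ∈ G.flowLattice, quad (x - m) ≤ quad (x - m') := by
  set A : Set (OEdge E → ℝ) := {m | m ∈ G.flowLattice ∧ quad (x - m) ≤ quad x} with hA
  have h0 : (0 : OEdge E → ℝ) ∈ A := ⟨G.flowLattice.zero_mem, by simp⟩
  have hfin : A.Finite := by
    -- A lattice point no farther from `x` than 0 is has each coordinate within `R` of that of `x`,
    -- so its integer coordinates lie in a finite box.
    set R : ℝ := Real.sqrt (quad x)
    let B : Set (E → ℤ) := Set.Icc (fun e => ⌊x (e, true) - R⌋) (fun e => ⌈x (e, true) + R⌉)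
    have hB : B.Finite := Set.finite_Icc _ _
    refine (hB.image fun n => extend (WithLp.toLp 2 fun e => (n e : ℝ))).subset ?_
    rintro m ⟨hm, hq⟩
    obtain ⟨n, hn⟩ := exists_int_of_mem_flowLattice hm
    have hle : ∀ e, |x (e, true) - n e| ≤ R := by
      intro e
      refine Real.abs_le_sqrt (le_trans ?_ hq)
      rw [quad_eq_norm_sq, norm_sq_eq_sum]
      have := Finset.single_le_sum (f := fun e => coord (x - m) e ^ 2)
        (fun e _ => sq_nonneg _) (Finset.mem_univ e)
      rw [← hn e]
      exact this
    refine ⟨n, ⟨fun e => ?_, fun e => ?_⟩, ?_⟩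
    · have := (abs_le.1 (hle e)).2
      exact Int.floor_le_iff.2 (by linarith)
    · have := (abs_le.1 (hle e)).1
      exact Int.le_ceil_iff.2 (by linarith)
    · have : WithLp.toLp 2 (fun e => (n e : ℝ)) = coord m := by
        ext e
        exact (hn e).symm
      simp only [this, extend_coord hm.1.1]
  obtain ⟨m, hm, hmin⟩ := Set.exists_min_image A (fun m => quad (x - m)) hfin ⟨0, h0⟩
  refine ⟨m, hm.1, fun m' hm' => ?_⟩
  by_cases h : quad (x - m') ≤ quad x
  · exact hmin m' ⟨hm', h⟩
  · exact hm.2.trans (not_le.1 h).le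

/-- The points of the Voronoi cell are projections of points of a cube. -/
lemma exists_grad_sub_le {G : MultiG V E} (hG : G.Connected) {y : EuclideanSpace ℝ E}
    (h : ∀ C, G.IsCircuit C → 2 * inner ℝ y (coord (circuitFlow C)) ≤ C.card) :
    ∃ f, ∀ e, |(y - G.grad f) e| ≤ 1 / 2 := by
  -- A circuit has weight ℓ(C)/2 - ⟨y, x^C⟩ ≥ 0 and opposite edges have total weight 1. The
  -- potential inequalities for the two orientations of an edge are the two sides of the bound by
  -- 1/2.
  obtain ⟨f, hf⟩ := exists_feasible_potential (G := G) (S := Set.univ)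
    (w := fun a => 1 / 2 - extend y a) (fun u v _ => hG.2 v u)
    (fun a _ _ => by rw [extend_rev]; linarith) (fun C hC _ => by
      have := h C hC
      rw [hC.inner_coord] at this
      rw [Finset.sum_sub_distrib, Finset.sum_const, nsmul_eq_mul]
      linarith)
  refine ⟨f, fun e => abs_le.2 ⟨?_, ?_⟩⟩
  · have := hf (e, false) trivial
    simp [tail, head, extend] at this
    simp [grad_apply]
    linarith
  · have := hf (e, true) trivial
    simp [tail, head, extend] at this
    simp [grad_apply]
    linarith

lemma isCoveringBound_of_maximal {G : MultiG V E} (hG : G.Connected) {r : ℝ}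
    (hr : ∀ t ∈ G.signVectors, ‖G.proj (WithLp.toLp 2 t)‖ ≤ r) :
    G.IsCoveringBound (r ^ 2 / 4) := by
  intro x hx
  obtain ⟨m, hm, hmin⟩ := G.exists_nearest_lattice_point x
  refine ⟨m, hm, ?_⟩
  have hflow : coord (x - m) ∈ G.flows := coord_mem_flows (G.flowSpace.sub_mem hx hm.1)
  obtain ⟨f, hf⟩ := exists_grad_sub_le hG (y := coord (x - m)) fun C hC => by
    have h1 := hmin _ (G.flowLattice.add_mem hm hC.circuitFlow_mem_flowLattice)
    have h2 : coord (x - (m + circuitFlow C)) = coord (x - m) - coord (circuitFlow C) := by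
      rw [← sub_sub]; rfl
    have h3 := hC.quad_circuitFlow
    rw [quad_eq_norm_sq] at h3
    rw [quad_eq_norm_sq, quad_eq_norm_sq, h2, norm_sub_sq_real, h3] at h1
    linarith
  -- Doubling carries the cube of half-side 1/2 to the cube spanned by signs, whence the factor 1/4
  -- in the bound.
  obtain ⟨t, ht, hle⟩ := G.exists_signVector_norm_le
    (y := (2 : ℝ) • (coord (x - m) - G.grad f)) fun e => by
      have := hf e
      rw [PiLp.smul_apply, smul_eq_mul, abs_mul, abs_two]
      linarith
  rw [map_smul, map_sub, proj_grad, sub_zero, proj_of_mem hflow, norm_smul] at hle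
  have h4 := hle.trans (hr t ht)
  have h5 := norm_nonneg (coord (x - m))
  rw [quad_eq_norm_sq]
  norm_num at h4
  nlinarith

/-- The flow of an orientation lies in the Voronoi cell of the lattice. -/
lemma quad_le_quad_sub {G : MultiG V E} {D : Finset (OEdge E)} (hD : G.IsStrongOrientation D)
    {v : OEdge E → ℝ} (hv : G.IsOrientationFlow D v) {m : OEdge E → ℝ} (hm : m ∈ G.flowLattice) :
    quad v ≤ quad (v - m) := by
  have hsub : coord (v - m) = coord v - coord m := rfl
  rw [quad_eq_norm_sq, quad_eq_norm_sq, hsub, norm_sub_sq_real, hD.eq_of_isOrientationFlow hv,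
    inner_smul_left, inner_proj_of_mem (coord_mem_flows hm.1), inner_eq_sum, norm_sq_eq_sum (coord m)]
  obtain ⟨n, hn⟩ := exists_int_of_mem_flowLattice hm
  -- For `v = P s / 2` the claim reduces to ⟨s, m⟩ ≤ ⟨m, m⟩, which holds edge by edge: s_e is 0 or
  -- ±1, and |n| ≤ n² for integers.
  have hle : ∑ e, signVec D e * coord m e ≤ ∑ e, coord m e ^ 2 := by
    refine Finset.sum_le_sum fun e _ => ?_
    rw [hn e]
    have h1 : |n e| ≤ n e ^ 2 := by
      rw [← Int.natCast_natAbs, ← Int.natAbs_sq]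
      exact_mod_cast Nat.le_self_pow two_ne_zero _
    have h2 : ((|n e| : ℤ) : ℝ) ≤ ((n e ^ 2 : ℤ) : ℝ) := by exact_mod_cast h1
    push_cast at h2
    have h3 := le_abs_self (n e : ℝ)
    have h4 := neg_abs_le (n e : ℝ)
    have h5 := sq_nonneg (n e : ℝ)
    obtain ⟨hb, hb'⟩ := mem_signVectors.1 hD.signVec_mem e
    by_cases he : G.IsBridge e
    · rw [hb he, zero_mul]; exact h5
    · rcases hb' he with h | h <;> rw [h] <;> linarith
  simp
  linarith

/-! ### Eulerian graphs -/

/-- A path carries an integer vector whose divergence is concentrated at its ends. -/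
lemma exists_int_divergence_single {G : MultiG V E} {S : Set (OEdge E)} {u v : V}
    (h : G.Reach S u v) :
    ∃ z : E → ℤ, ∀ f : V → ℝ, inner ℝ (G.grad f) (WithLp.toLp 2 fun e => (z e : ℝ)) = f u - f v := by
  induction h with
  | refl => exact ⟨0, fun f => by simp [inner_eq_sum]⟩
  | tail _ h ih =>
    obtain ⟨a, -, rfl, rfl⟩ := h
    obtain ⟨z, hz⟩ := ih
    refine ⟨z + Pi.single a.1 (if a.2 then 1 else -1), fun f => ?_⟩
    have h1 := hz f
    have h2 := extend_grad G f a
    rw [inner_eq_sum] at h1 ⊢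
    simp only [Pi.add_apply, Int.cast_add, mul_add, Finset.sum_add_distrib]
    rw [h1, Finset.sum_eq_single a.1 (fun e _ he => by simp [he]) (by simp)]
    rcases a with ⟨e, _ | _⟩ <;> simp [extend] at h2 ⊢ <;> linarith

/-- Integer vertex functions of sum zero are divergences of integer vectors. -/
lemma exists_int_divergence {G : MultiG V E} (hG : G.Connected) (h : V → ℤ)
    (hsum : ∑ v, h v = 0) :
    ∃ z : E → ℤ, ∀ f : V → ℝ,
      inner ℝ (G.grad f) (WithLp.toLp 2 fun e => (z e : ℝ)) = ∑ v, f v * h v := by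
  obtain ⟨u⟩ := hG.1
  choose z hz using fun v => exists_int_divergence_single (hG.2 v u)
  -- Each `v` sends `h v` units along a path to the root `u`; the total arriving at `u` is the sum
  -- of `h`, which vanishes.
  refine ⟨fun e => ∑ v, h v * z v e, fun f => ?_⟩
  have hvec : (WithLp.toLp 2 fun e => ((∑ v, h v * z v e : ℤ) : ℝ)) =
      ∑ v, (h v : ℝ) • (WithLp.toLp 2 fun e => (z v e : ℝ) : EuclideanSpace ℝ E) := by
    ext e
    simp
  rw [hvec, inner_sum]
  simp only [inner_smul_right, hz]
  have hsum' : ∑ v, (h v : ℝ) = 0 := by exact_mod_cast hsum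
  simp only [mul_sub, Finset.sum_sub_distrib, ← Finset.sum_mul, hsum', zero_mul, sub_zero]
  exact Finset.sum_congr rfl fun v _ => mul_comm _ _

/-- An Eulerian graph has an integer flow with odd values only. -/
lemma IsEulerian.exists_odd_flow {G : MultiG V E} (hG : G.Connected) (hE : G.IsEulerian) :
    ∃ n : E → ℤ, (WithLp.toLp 2 fun e => (n e : ℝ)) ∈ G.flows ∧ ∀ e, Odd (n e) := by
  -- The divergence of the all-ones vector has the parity of the degree, so it is even. Half of it
  -- is the divergence of an integer vector `z`, and `o - 2 z` is an integer flow with odd entries.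
  set o : EuclideanSpace ℝ E := WithLp.toLp 2 fun _ => 1
  let d : V → ℤ := fun v =>
    ∑ a ∈ Finset.univ.filter (fun a : OEdge E => G.tail a = v), if a.2 then 1 else -1
  have hd : ∀ v, G.divergence o v = d v := by
    intro v
    simp only [divergence, d, Int.cast_sum]
    refine Finset.sum_congr rfl fun a _ => ?_
    rcases a with ⟨e, _ | _⟩ <;> simp [extend, o]
  have heven : ∀ v, Even (d v) := by
    intro v
    have h1 : Even (d v - ((Finset.univ.filter (fun a : OEdge E => G.tail a = v)).card : ℤ)) := by
      rw [Finset.card_eq_sum_ones, Nat.cast_sum, ← Finset.sum_sub_distrib]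
      refine Finset.even_sum _ fun a _ => ?_
      rcases a with ⟨e, _ | _⟩ <;> simp
    have h2 : Even ((Finset.univ.filter (fun a : OEdge E => G.tail a = v)).card : ℤ) := by
      exact_mod_cast hE v
    simpa using h1.add h2
  choose h hh using fun v => (heven v).two_dvd
  have hsum : ∑ v, h v = 0 := by
    have h1 : ∑ v, d v = 0 := by
      have h2 : inner ℝ (G.grad fun _ => 1) o = ∑ v, 1 * G.divergence o v := inner_grad_left _ _ _
      have h3 : G.grad (fun _ => 1) = 0 := by ext e; simp [grad_apply]
      rw [h3, inner_zero_left] at h2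
      simp only [hd, one_mul] at h2
      exact_mod_cast h2.symm
    simp only [hh, ← Finset.mul_sum] at h1
    omega
  obtain ⟨z, hz⟩ := exists_int_divergence hG h hsum
  refine ⟨fun e => 1 - 2 * z e, ?_, fun e => ⟨- z e, by ring⟩⟩
  have hvec : (WithLp.toLp 2 fun e => ((1 - 2 * z e : ℤ) : ℝ)) =
      o - (2 : ℝ) • (WithLp.toLp 2 fun e => (z e : ℝ)) := by
    ext e
    simp [o]
  rw [hvec, mem_flows_iff_inner]
  intro f
  rw [inner_sub_right, inner_smul_right, hz, inner_grad_left, Finset.mul_sum,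
    ← Finset.sum_sub_distrib]
  refine Finset.sum_eq_zero fun v _ => ?_
  rw [hd, hh]
  push_cast
  ring

/-- Half of an odd integer flow has all coordinates in 1/2 + ℤ, so on each edge it differs from any
integer flow by at least 1/2. -/
lemma IsEulerian.card_div_four_le {G : MultiG V E} (hG : G.Connected) (hE : G.IsEulerian) {r : ℝ}
    (hr : G.IsCoveringBound r) : (Fintype.card E : ℝ) / 4 ≤ r := by
  obtain ⟨n, hn, hodd⟩ := hE.exists_odd_flow hG
  set y : EuclideanSpace ℝ E := WithLp.toLp 2 fun e => (n e : ℝ) with hy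
  obtain ⟨m, hm, hle⟩ := hr (extend ((1 / 2 : ℝ) • y))
    (extend_mem_flowSpace.2 (G.flows.smul_mem _ hn))
  refine le_trans ?_ hle
  obtain ⟨k, hk⟩ := exists_int_of_mem_flowLattice hm
  have hsub : coord (extend ((1 / 2 : ℝ) • y) - m) = (1 / 2 : ℝ) • y - coord m := by
    rw [← coord_extend ((1 / 2 : ℝ) • y)]; rfl
  have hconst : (Fintype.card E : ℝ) / 4 = ∑ _e : E, (1 / 4 : ℝ) := by
    simp; ring
  rw [quad_eq_norm_sq, hsub, norm_sq_eq_sum, hconst]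
  refine Finset.sum_le_sum fun e _ => ?_
  obtain ⟨j, hj⟩ := hodd e
  have h1 : ((1 / 2 : ℝ) • y - coord m) e = ((2 * (j - k e) + 1 : ℤ) : ℝ) / 2 := by
    simp [hy, hk, hj]; ring
  have h2 : (1 : ℤ) ≤ (2 * (j - k e) + 1) ^ 2 := by
    have : 2 * (j - k e) + 1 ≠ 0 := by omega
    have := sq_pos_of_ne_zero this
    omega
  have h3 : (1 : ℝ) ≤ ((2 * (j - k e) + 1 : ℤ) : ℝ) ^ 2 := by exact_mod_cast h2
  rw [h1, div_pow]
  linarith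

lemma numNonBridge_le_card (G : MultiG V E) : G.numNonBridge ≤ Fintype.card E := by
  rw [numNonBridge, ← Nat.card_eq_fintype_card]
  exact Finite.card_subtype_le _

lemma energy_nonneg (G : MultiG V E) (f : V → ℝ) : 0 ≤ G.energy f := by
  rw [energy_eq_norm_sq]
  positivity

end MultiG

/-! ### Assembly -/

theorem mainTheorem8 {V E : Type*} [Fintype V] [DecidableEq V] [Fintype E] [DecidableEq E]
    (G : MultiG V E) (hG : G.Connected) :
    -- the covering number is attained: it is the smallest `r` whose balls cover
    IsLeast {r : ℝ | G.IsCoveringBound r} G.coveringNumber ∧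
    -- each strongly connected orientation `D` has a unique flow `v^D`
    (∀ D, G.IsStrongOrientation D → ∃! v, G.IsOrientationFlow D v) ∧
    -- the covering number is the maximum of `q (v^D)`
    IsGreatest {s : ℝ | ∃ D v, G.IsStrongOrientation D ∧ G.IsOrientationFlow D v ∧
      s = MultiG.quad v} G.coveringNumber ∧
    -- each Laplacian equation has a solution `f_D`, unique up to an additive constant
    (∀ D, G.IsStrongOrientation D → ∃ f, G.IsPotential D f ∧
      ∀ f', G.IsPotential D f' → ∃ c : ℝ, ∀ y, f' y = f y + c) ∧
    -- well-balanced orientations exist, and each of them computes the covering number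
    (∃ D, G.IsWellBalanced D) ∧
    (∀ D f, G.IsWellBalanced D → G.IsPotential D f →
      G.coveringNumber = (G.numNonBridge : ℝ) / 4 - G.energy f / 4) ∧
    -- the Eulerian case
    (G.IsEulerian → G.coveringNumber = (Fintype.card E : ℝ) / 4) := by
  obtain ⟨D₀, hD₀, hmax⟩ := G.exists_maximal_isStrongOrientation
  have hlower : ∀ D v, G.IsStrongOrientation D → G.IsOrientationFlow D v →
      ∀ r, G.IsCoveringBound r → MultiG.quad v ≤ r := by
    intro D v hD hv r hr
    obtain ⟨m, hm, hle⟩ := hr v hv.1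
    exact (MultiG.quad_le_quad_sub hD hv hm).trans hle
  have hbound := MultiG.isCoveringBound_of_maximal hG hmax
  have hleast : IsLeast {r : ℝ | G.IsCoveringBound r}
      (‖G.proj (MultiG.signVec D₀)‖ ^ 2 / 4) := by
    refine ⟨hbound, fun r hr => ?_⟩
    rw [← hD₀.quad_eq_of_isOrientationFlow hD₀.isOrientationFlow]
    exact hlower _ _ hD₀ hD₀.isOrientationFlow r hr
  have hcov : G.coveringNumber = ‖G.proj (MultiG.signVec D₀)‖ ^ 2 / 4 := hleast.csInf_eq
  have hcovE : ∀ f, G.IsPotential D₀ f →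
      G.coveringNumber = (G.numNonBridge : ℝ) / 4 - G.energy f / 4 := by
    intro f hf
    rw [hcov, hD₀.norm_proj_signVec_sq hf]
    ring
  have hmin : ∀ D f f', G.IsPotential D₀ f → G.IsStrongOrientation D → G.IsPotential D f' →
      G.energy f ≤ G.energy f' := by
    intro D f f' hf hD hf'
    have h1 := pow_le_pow_left₀ (norm_nonneg _) (hmax _ hD.signVec_mem) 2
    rw [hD₀.norm_proj_signVec_sq hf] at h1
    have h2 := hD.norm_proj_signVec_sq hf'
    rw [WithLp.toLp_ofLp] at h1
    linarith
  obtain ⟨f₀, hf₀⟩ := G.exists_isPotential D₀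
  refine ⟨hcov ▸ hleast, fun D hD => hD.existsUnique_isOrientationFlow, ⟨?_, ?_⟩, ?_, ?_, ?_, ?_⟩
  · exact ⟨D₀, _, hD₀, hD₀.isOrientationFlow,
      by rw [hcov, hD₀.quad_eq_of_isOrientationFlow hD₀.isOrientationFlow]⟩
  · rintro _ ⟨D, v, hD, hv, rfl⟩
    rw [hcov]
    exact hlower D v hD hv _ hbound
  · intro D _
    obtain ⟨f, hf⟩ := G.exists_isPotential D
    exact ⟨f, hf, fun f' hf' => hf.exists_eq_add hG hf'⟩
  · exact ⟨D₀, hD₀, f₀, hf₀, fun D f' hD hf' => hmin D f₀ f' hf₀ hD hf'⟩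
  -- `D` and the maximizing `D₀` both have minimal energy, so the formula for `D₀` carries over to
  -- `D`.
  · rintro D f ⟨hD, f', hf', hbest⟩ hf
    rw [hcovE f₀ hf₀, hf.energy_eq hf',
      le_antisymm (hmin D f₀ f' hf₀ hD hf') (hbest D₀ f₀ hD₀ hf₀)]
  · intro hE
    -- The upper bound needs only ε ≤ |E| and nonnegative energy.
    refine le_antisymm ?_ (hE.card_div_four_le hG (hcov ▸ hbound))
    have h1 : (G.numNonBridge : ℝ) ≤ Fintype.card E := by exact_mod_cast G.numNonBridge_le_card
    have h2 := G.energy_nonneg f₀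
    rw [hcovE f₀ hf₀]
    linarith
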